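/- All topological monoids below have jointly continuous multiplication. A topological monoid $S$ is called right non-archimedean (r-NA) if there exist a Stone space $Y$ (a compact Hausdorff space whose clopen subsets form a basis of its topology), a continuous right action $Y\times S\to Y$ of the monoid $S$, and a topological embedding $\nu\colon S\to Y$ with dense image such that $\nu(xs)=\nu(x)s$ for all $x,s\in S$. The weight $w(X)$ of a topological space $X$ is the least cardinality of a basis of its topology. For a set $D$, let $D^D$ be the monoid of all maps $D\to D$ under composition, $(fg)(a)=f(g(a))$, with the pointwise topology, that is, the product topology of the discrete topologies on the factors $D$; it is a topological monoid. An embedding of topological monoids is a homomorphism that preserves the identity and is a topological embedding. Theorem. (1) $\mathbb{N}^{\mathbb{N}}$ is a Polish r-NA monoid, and every separable metrizable r-NA monoid embeds, as a topological monoid, into $\mathbb{N}^{\mathbb{N}}$. (2) More generally, let $D$ be an infinite set of cardinality $\kappa$, so that $D^D$ is $\kappa^\kappa$. Then $D^D$ is an r-NA monoid of weight $\kappa$, and every r-NA monoid $S$ with $w(S)\le\kappa$ embeds, as a topological monoid, into $D^D$. -/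

import Mathlib

open Cardinal TopologicalSpace Topology

universe u v

/-- The weight of a topological space: the least cardinality of a basis of its topology. -/
noncomputable def topWeight (X : Type u) [TopologicalSpace X] : Cardinal.{u} :=
  sInf {c : Cardinal.{u} | ∃ B : Set (Set X), IsTopologicalBasis B ∧ #B = c}

/-- A Stone space: a compact Hausdorff space whose clopen subsets form a basis of the topology. -/
structure IsStoneSpace (Y : Type u) [TopologicalSpace Y] : Prop where
  compact : CompactSpace Y
  hausdorff : T2Space Y
  zero_dimensional : IsTopologicalBasis {U : Set Y | IsClopen U}

/-- The (continuous, left, monoidal) action of the topological monoid `S` on `X` is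
non-archimedean: there is a proper `S`-compactification `ν : X → Y` with `Y` a Stone space, that is,
a Stone space `Y` with a continuous action of `S`, and an equivariant topological embedding `ν` of
`X` onto a dense subset of `Y`. (As `Y` has a dense subset indexed by `X`, it is no restriction to
take `Y` in the universe of `X`.) -/
def IsNAAction (S : Type v) [Monoid S] [TopologicalSpace S]
    (X : Type u) [TopologicalSpace X] [MulAction S X] [ContinuousSMul S X] : Prop :=
  ∃ (Y : Type u) (_ : TopologicalSpace Y) (_ : MulAction S Y) (ν : X →[S] Y),
    IsStoneSpace Y ∧ ContinuousSMul S Y ∧ IsEmbedding ν ∧ DenseRange ν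

/-- A topological monoid `S` is right non-archimedean (r-NA) if the right action of `S` on itself,
`(x, s) ↦ x * s`, is non-archimedean. A right action of `S` is an action of the opposite monoid
`Sᵐᵒᵖ`, and `MulOpposite.op s • x = x * s`. -/
def IsRightNA (S : Type u) [Monoid S] [TopologicalSpace S] [ContinuousMul S] : Prop :=
  IsNAAction Sᵐᵒᵖ S

/-- The topological monoid `S` embeds into the topological monoid `T` as a topological submonoid:
there is an identity-preserving homomorphism `S → T` which is a topological embedding. -/
def EmbedsAsTopologicalSubmonoid (S : Type u) [Monoid S] [TopologicalSpace S]
    (T : Type v) [Monoid T] [TopologicalSpace T] : Prop :=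
  ∃ φ : S →* T, IsEmbedding φ

/-- The pointwise topology on the monoid `D ^ D` of all self-maps of the discrete set `D` (with
composition as multiplication), that is, the product topology of the discrete topologies. -/
instance Function.End.pointwiseTopology (D : Type u) : TopologicalSpace (Function.End D) :=
  @Pi.topologicalSpace D (fun _ => D) (fun _ => ⊥)

/-- `D ^ D` with composition and the pointwise topology is a topological monoid. -/
instance Function.End.continuousMul_pointwise (D : Type u) : ContinuousMul (Function.End D) := by
  let _ : TopologicalSpace D := ⊥
  have _ : DiscreteTopology D := ⟨rfl⟩
  have ev : ∀ a : D, Continuous (fun f : Function.End D => f a) := fun a =>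
    continuous_apply (A := fun _ : D => D) a
  refine ⟨continuous_pi (A := fun _ : D => D) fun a => continuous_iff_continuousAt.2 ?_⟩
  rintro ⟨f, g⟩
  have h1 : ∀ᶠ p : Function.End D × Function.End D in 𝓝 (f, g), p.2 a = g a :=
    (((isOpen_discrete {g a}).preimage (ev a)).preimage continuous_snd).mem_nhds rfl
  have h2 : ∀ᶠ p : Function.End D × Function.End D in 𝓝 (f, g), p.1 (g a) = f (g a) :=
    (((isOpen_discrete {f (g a)}).preimage (ev (g a))).preimage continuous_fst).mem_nhds rfl
  have h3 : (fun p : Function.End D × Function.End D => (p.1 * p.2) a)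
      =ᶠ[𝓝 (f, g)] fun _ => (f * g) a := by
    filter_upwards [h1, h2] with p hp1 hp2
    change p.1 (p.2 a) = f (g a)
    rw [hp1, hp2]
  exact (continuousAt_const (y := (f * g) a)).congr h3.symm

open MulOpposite Filter

/-! ### Bounds for the weight. -/

section Weight

/-! If `S` acts on the Stone space `Y` from the right, it acts from the left on the clopen sets by
preimages. For fixed clopen `U`, the preimage under `s` is locally constant in `s`, because `Y` is
compact. It contains `ν 1` exactly when `ν s ∈ U`, so these preimages recover the topology of `S`.
Since `w(S) ≤ κ`, at most `κ` clopen sets separate enough, and local constancy bounds the union of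
their orbits by `κ`. The action on this union, padded by fixed points, embeds `S` into `D ^ D`. That
`D ^ D` is itself r-NA is seen in `(βD) ^ D`. -/

theorem exists_isTopologicalBasis_card_eq_topWeight (X : Type u) [TopologicalSpace X] :
    ∃ B : Set (Set X), IsTopologicalBasis B ∧ #B = topWeight X :=
  csInf_mem (s := {c : Cardinal.{u} | ∃ B : Set (Set X), IsTopologicalBasis B ∧ #B = c})
    ⟨_, _, isTopologicalBasis_opens, rfl⟩

theorem TopologicalSpace.IsTopologicalBasis.topWeight_le {X : Type u} [TopologicalSpace X]
    {B : Set (Set X)} (hB : IsTopologicalBasis B) : topWeight X ≤ #B :=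
  csInf_le' ⟨B, hB, rfl⟩

theorem topWeight_le_aleph0 (X : Type u) [TopologicalSpace X] [SecondCountableTopology X] :
    topWeight X ≤ ℵ₀ :=
  (isBasis_countableBasis X).topWeight_le.trans (countable_countableBasis X).le_aleph0

/-- A space that is generated by an infinite family of sets has weight at most the cardinality of
the index set. -/
theorem topWeight_le_of_generateFrom {X ι : Type u} [t : TopologicalSpace X] [Infinite ι]
    {s : ι → Set X} (hs : t = generateFrom (Set.range s)) : topWeight X ≤ #ι := by
  classical
  refine (isTopologicalBasis_of_subbasis hs).topWeight_le.trans ?_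
  have hsub : (fun f => ⋂₀ f) '' {f : Set (Set X) | f.Finite ∧ f ⊆ Set.range s} ⊆
      Set.range (fun F : Finset ι => ⋂ i ∈ F, s i) := by
    rintro _ ⟨f, ⟨hf, hfs⟩, rfl⟩
    lift f to Finset (Set X) using hf
    rw [← Set.image_univ] at hfs
    obtain ⟨F, -, rfl⟩ := Finset.subset_set_image_iff.1 hfs
    exact ⟨F, by simp [Set.sInter_image]⟩
  exact (mk_le_mk_of_subset hsub).trans (mk_range_le.trans (mk_finset_of_infinite ι).le)

/-- A family of pairwise disjoint nonempty open sets is no larger than the weight. -/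
theorem mk_le_topWeight_of_pairwise_disjoint {X ι : Type u} [TopologicalSpace X] {s : ι → Set X}
    (ho : ∀ i, IsOpen (s i)) (hne : ∀ i, (s i).Nonempty)
    (hd : Pairwise (Function.onFun Disjoint s)) : #ι ≤ topWeight X := by
  obtain ⟨B, hB, hc⟩ := exists_isTopologicalBasis_card_eq_topWeight X
  rw [← hc]
  choose x hx using hne
  choose b hbB hxb hbs using fun i => hB.exists_subset_of_mem_open (hx i) (ho i)
  refine mk_le_of_injective (f := fun i => (⟨b i, hbB i⟩ : B)) fun i j hij => ?_
  by_contra hne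
  have hij : b i = b j := congrArg Subtype.val hij
  exact Set.disjoint_left.1 (hd hne) (hx i) (hbs j (hij ▸ hxb i))

end Weight

/-! ### The monoid `D ^ D` and embeddings into it. -/

namespace Function.End

theorem isOpen_setOf_apply_eq {D : Type u} (a d : D) : IsOpen {f : Function.End D | f a = d} := by
  let _ : TopologicalSpace D := ⊥
  have _ : DiscreteTopology D := ⟨rfl⟩
  exact (isOpen_discrete {d}).preimage (continuous_apply (A := fun _ : D => D) a)

theorem topology_eq_generateFrom (D : Type u) :
    Function.End.pointwiseTopology D =
      generateFrom (Set.range fun p : D × D => {f : Function.End D | f p.1 = p.2}) := by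
  refine le_antisymm (le_generateFrom ?_) ?_
  · rintro _ ⟨p, rfl⟩
    exact isOpen_setOf_apply_eq p.1 p.2
  · let _ : TopologicalSpace D := ⊥
    have _ : DiscreteTopology D := ⟨rfl⟩
    refine le_iInf fun a => ?_
    refine continuous_iff_le_induced.1 ?_
    refine @Continuous.mk _ _ (_) _ _ fun U _ => ?_
    have hU : (fun f : Function.End D => f a) ⁻¹' U =
        ⋃ d ∈ U, {f : Function.End D | f a = d} := by
      refine Set.ext fun f => ⟨fun hf => Set.mem_biUnion (x := f a) hf rfl, fun hf => ?_⟩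
      obtain ⟨d, hd, rfl⟩ := Set.mem_iUnion₂.1 hf
      exact hd
    refine (congrArg (@IsOpen _ (generateFrom _)) hU).mpr ?_
    refine @isOpen_iUnion _ _ (_) _ fun d => @isOpen_iUnion _ _ (_) _ fun _ => ?_
    exact isOpen_generateFrom_of_mem ⟨(a, d), rfl⟩

theorem topWeight_eq (D : Type u) [Infinite D] : topWeight (Function.End D) = #D := by
  refine le_antisymm ?_ ?_
  · have h := topWeight_le_of_generateFrom (topology_eq_generateFrom D)
    rwa [← Cardinal.mul_def, mul_eq_self (aleph0_le_mk D)] at h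
  · obtain ⟨a⟩ : Nonempty D := inferInstance
    refine mk_le_topWeight_of_pairwise_disjoint
      (s := fun d => {f : Function.End D | f a = d}) (fun d => isOpen_setOf_apply_eq a d)
      (fun d => ⟨fun _ => d, rfl⟩) fun d e hde => Set.disjoint_left.2 fun f hd he => hde ?_
    exact (hd : f a = d).symm.trans he

/-- The action of `D ^ D` from the right on the functions on `D`, by composition. -/
abbrev precompAction (D : Type u) (Z : Type v) : MulAction (Function.End D)ᵐᵒᵖ (D → Z) where
  smul s y := fun a => y (s.unop a)
  one_smul _ := rfl
  mul_smul _ _ _ := rfl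

/-- `D ^ D` is r-NA: it is dense in `(βD) ^ D`, on which it acts by composition. -/
theorem isRightNA (D : Type u) : IsRightNA (Function.End D) := by
  let _ : TopologicalSpace D := ⊥
  have _ : DiscreteTopology D := ⟨rfl⟩
  let _ := precompAction D (Ultrafilter D)
  refine ⟨D → Ultrafilter D, inferInstance, inferInstance,
    ⟨fun f a => pure (f a), fun _ _ => rfl⟩,
    ⟨inferInstance, inferInstance, isTopologicalBasis_isClopen⟩, ⟨?_⟩, ?_, ?_⟩
  · refine continuous_pi fun a => continuous_iff_continuousAt.2 ?_
    rintro ⟨s, y⟩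
    -- The index `s.unop a` is locally constant, so the action agrees locally with a coordinate
    -- projection.
    have hs : ∀ᶠ p : (Function.End D)ᵐᵒᵖ × (D → Ultrafilter D) in 𝓝 (s, y),
        p.1.unop a = s.unop a :=
      ((isOpen_setOf_apply_eq a (s.unop a)).preimage
        (continuous_unop.comp continuous_fst)).mem_nhds rfl
    have hc : Continuous fun p : (Function.End D)ᵐᵒᵖ × (D → Ultrafilter D) => p.2 (s.unop a) :=
      (continuous_apply _).comp continuous_snd
    refine hc.continuousAt.congr ?_
    filter_upwards [hs] with p hp
    exact congrArg p.2 hp.symm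
  · have h : IsEmbedding (pure : D → Ultrafilter D) :=
      ⟨isDenseInducing_pure.isInducing, Ultrafilter.pure_injective⟩
    exact IsEmbedding.piMap (fun _ : D => h)
  · exact DenseRange.piMap fun _ : D => denseRange_pure

theorem polishSpace_nat : PolishSpace (Function.End ℕ) :=
  inferInstanceAs (PolishSpace (ℕ → ℕ))

/-- A representation of `S` by self-maps of a set is a topological embedding if it is pointwise
locally constant and values at single points determine neighbourhoods. -/
theorem isEmbedding_of_forall_nhds {S : Type u} {D : Type v} [TopologicalSpace S] [T0Space S]
    {φ : S → Function.End D} (hcont : ∀ s a, ∀ᶠ t in 𝓝 s, φ t a = φ s a)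
    (hsep : ∀ s, ∀ O ∈ 𝓝 s, ∃ a, ∀ t, φ t a = φ s a → t ∈ O) : IsEmbedding φ := by
  have hφ : Continuous φ := by
    let _ : TopologicalSpace D := ⊥
    refine continuous_pi (A := fun _ : D => D) fun a => continuous_iff_continuousAt.2 fun s => ?_
    exact (continuousAt_const (y := φ s a)).congr ((hcont s a).mono fun t ht => ht.symm)
  have : IsInducing φ := isInducing_iff_nhds.2 fun s => by
    refine le_antisymm (map_le_iff_le_comap.1 hφ.continuousAt) fun O hO => ?_
    obtain ⟨a, ha⟩ := hsep s O hO
    exact ⟨_, (isOpen_setOf_apply_eq a (φ s a)).mem_nhds rfl, ha⟩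
  exact this.isEmbedding

/-- A monoid with a pointwise locally constant, topology-determining action on an invariant subset `A` of `X`, with `A` no larger than
the infinite set `D`, embeds into `D ^ D`. -/
theorem embedsAsTopologicalSubmonoid_of_invariant {S : Type u} [Monoid S] [TopologicalSpace S]
    [T0Space S] {X : Type u} (ρ : S →* Function.End X) {A : Set X}
    (hA : ∀ s, ∀ x ∈ A, ρ s x ∈ A) (hcont : ∀ s, ∀ x ∈ A, ∀ᶠ t in 𝓝 s, ρ t x = ρ s x)
    (hsep : ∀ s, ∀ O ∈ 𝓝 s, ∃ x ∈ A, ∀ t, ρ t x = ρ s x → t ∈ O)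
    (D : Type v) [Infinite D] (hcard : lift.{v} #A ≤ lift.{u} #D) :
    EmbedsAsTopologicalSubmonoid S (Function.End D) := by
  have hsum : lift.{v} #(A ⊕ D) = lift.{max u v} #D := by
    rw [mk_sum, add_eq_right (by simp) hcard, Cardinal.lift_lift, Cardinal.lift_umax.{v, u}]
  obtain ⟨e⟩ := lift_mk_eq'.1 hsum
  let τ : S → A → A := fun s x => ⟨ρ s x, hA s x x.2⟩
  let φ : S →* Function.End D :=
    { toFun := fun s d => e (Sum.map (τ s) id (e.symm d))
      map_one' := by
        funext d
        have : τ 1 = id := by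
          funext x
          exact Subtype.ext (congrFun (map_one ρ) x.1)
        change e (Sum.map (τ 1) id (e.symm d)) = d
        rw [this, Sum.map_id_id, id, e.apply_symm_apply]
      map_mul' := fun s t => by
        funext d
        have : τ (s * t) = τ s ∘ τ t := by
          funext x
          exact Subtype.ext (congrFun (map_mul ρ s t) x.1)
        change e (Sum.map (τ (s * t)) id (e.symm d)) =
          e (Sum.map (τ s) id (e.symm (e (Sum.map (τ t) id (e.symm d)))))
        rw [this, e.symm_apply_apply, Sum.map_map, Function.id_comp] }
  refine ⟨φ, isEmbedding_of_forall_nhds (fun s d => ?_) fun s O hO => ?_⟩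
  · change ∀ᶠ t in 𝓝 s, e (Sum.map (τ t) id (e.symm d)) = e (Sum.map (τ s) id (e.symm d))
    rcases e.symm d with x | d'
    · filter_upwards [hcont s x x.2] with t ht
      have : τ t x = τ s x := Subtype.ext ht
      simp [this]
    · simp
  · obtain ⟨x, hx, h⟩ := hsep s O hO
    refine ⟨e (Sum.inl ⟨x, hx⟩), fun t ht => h t ?_⟩
    have : e (Sum.map (τ t) id (e.symm (e (Sum.inl ⟨x, hx⟩)))) =
      e (Sum.map (τ s) id (e.symm (e (Sum.inl ⟨x, hx⟩)))) := ht
    simpa [τ] using this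

end Function.End

/-! ### The action on clopen sets and universality. -/

section Universality

/-- A right action of `S` on `Y` induces a left action on the subsets of `Y` by preimages. -/
def preimageHom (S : Type u) [Monoid S] (Y : Type u) [MulAction Sᵐᵒᵖ Y] :
    S →* Function.End (Set Y) where
  toFun s U := {y | op s • y ∈ U}
  map_one' := by
    funext U
    ext y
    exact iff_of_eq (congrArg (· ∈ U) (one_smul Sᵐᵒᵖ y))
  map_mul' s t := by
    funext U
    ext y
    exact iff_of_eq (congrArg (· ∈ U) (mul_smul (op t) (op s) y))

theorem mem_preimageHom {S : Type u} [Monoid S] {Y : Type u} [MulAction Sᵐᵒᵖ Y] {s : S}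
    {U : Set Y} {y : Y} : y ∈ preimageHom S Y s U ↔ op s • y ∈ U :=
  Iff.rfl

variable {S : Type u} [Monoid S] [TopologicalSpace S] {Y : Type u} [TopologicalSpace Y]
  [MulAction Sᵐᵒᵖ Y] [ContinuousSMul Sᵐᵒᵖ Y]

theorem IsClopen.preimageHom {U : Set Y} (hU : IsClopen U) (s : S) :
    IsClopen (preimageHom S Y s U) :=
  hU.preimage (continuous_const_smul (op s))

/-- Near each `(s, y)` membership in the clopen `U` does not change; compactness of `Y` makes the
neighbourhood of `s` uniform in `y`. -/
theorem IsClopen.eventually_preimageHom_eq [CompactSpace Y] {U : Set Y} (hU : IsClopen U)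
    (s : S) : ∀ᶠ t in 𝓝 s, _root_.preimageHom S Y t U = _root_.preimageHom S Y s U := by
  have hc : Continuous fun p : S × Y => op p.1 • p.2 :=
    (continuous_op.comp continuous_fst).smul continuous_snd
  have key : ∀ y ∈ (Set.univ : Set Y), ∀ᶠ p : S × Y in 𝓝 (s, y),
      (op p.1 • p.2 ∈ U ↔ op s • p.2 ∈ U) := fun y _ => by
    have hs : Continuous fun p : S × Y => op s • p.2 := continuous_snd.const_smul _
    by_cases hy : op s • y ∈ U
    · filter_upwards [(hU.isOpen.preimage hc).mem_nhds hy,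
        (hU.isOpen.preimage hs).mem_nhds hy] with p h1 h2
      exact iff_of_true h1 h2
    · filter_upwards [(hU.compl.isOpen.preimage hc).mem_nhds hy,
        (hU.compl.isOpen.preimage hs).mem_nhds hy] with p h1 h2
      exact iff_of_false h1 h2
  filter_upwards [isCompact_univ.eventually_forall_of_forall_eventually
    (P := fun t y => op t • y ∈ U ↔ op s • y ∈ U) key] with t ht
  ext y
  exact ht y trivial

/-- An r-NA monoid of weight at most the cardinality of the infinite set `D` embeds into
`D ^ D`. -/
theorem IsRightNA.embedsAsTopologicalSubmonoid {S : Type u} [Monoid S] [TopologicalSpace S]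
    [ContinuousMul S] (hS : IsRightNA S) (D : Type v) [Infinite D]
    (hw : Cardinal.lift.{v} (topWeight S) ≤ Cardinal.lift.{u} #D) :
    EmbedsAsTopologicalSubmonoid S (Function.End D) := by
  obtain ⟨Y, _, _, ν, ⟨_, _, hY⟩, _, hν, -⟩ := hS
  have _ : T0Space S := hν.t0Space
  obtain ⟨B, hB, hc⟩ := exists_isTopologicalBasis_card_eq_topWeight S
  rw [← hc] at hw
  -- One clopen set per pair of basic sets, interpolating between them if possible and `∅`
  -- otherwise.
  have hex : ∀ b : B × B, ∃ U : Set Y, IsClopen U ∧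
      ((∃ V : Set Y, IsClopen V ∧ b.1.1 ⊆ ν ⁻¹' V ∧ ν ⁻¹' V ⊆ b.2.1) →
        b.1.1 ⊆ ν ⁻¹' U ∧ ν ⁻¹' U ⊆ b.2.1) := fun b => by
    by_cases h : ∃ V : Set Y, IsClopen V ∧ b.1.1 ⊆ ν ⁻¹' V ∧ ν ⁻¹' V ⊆ b.2.1
    · obtain ⟨V, hV, h'⟩ := h
      exact ⟨V, hV, fun _ => h'⟩
    · exact ⟨∅, isClopen_empty, fun h' => absurd h' h⟩
  choose U hU hUB using hex
  have hp : ∀ b : B, ∃ s : S, b.1.Nonempty → s ∈ b.1 := fun b => by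
    by_cases h : b.1.Nonempty
    · exact ⟨h.some, fun _ => h.some_mem⟩
    · exact ⟨1, fun h' => absurd h' h⟩
  choose p hp using hp
  let A : Set (Set Y) := Set.range fun q : S × (B × B) => preimageHom S Y q.1 (U q.2)
  -- By local constancy, `s` may be replaced by the chosen point of a basic set around it.
  have hAsub : A ⊆ Set.range fun q : B × (B × B) => preimageHom S Y (p q.1) (U q.2) := by
    rintro _ ⟨⟨s, b⟩, rfl⟩
    obtain ⟨c, hcB, hsc, hcs⟩ := hB.mem_nhds_iff.1 ((hU b).eventually_preimageHom_eq s)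
    exact ⟨(⟨c, hcB⟩, b), hcs (hp ⟨c, hcB⟩ ⟨s, hsc⟩)⟩
  have hAcard : lift.{v} #A ≤ lift.{u} #D := by
    have hD : ℵ₀ ≤ lift.{u} #D := by simp
    refine (lift_le.2 ((mk_le_mk_of_subset hAsub).trans mk_range_le)).trans ?_
    simp only [mk_prod, Cardinal.lift_id, Cardinal.lift_mul]
    exact mul_le_of_le hD hw (mul_le_of_le hD hw hw)
  refine Function.End.embedsAsTopologicalSubmonoid_of_invariant (preimageHom S Y) (A := A)
    ?_ ?_ ?_ D hAcard
  · rintro s _ ⟨⟨t, b⟩, rfl⟩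
    exact ⟨(s * t, b), congrFun (map_mul (preimageHom S Y) s t) (U b)⟩
  · rintro s _ ⟨⟨t, b⟩, rfl⟩
    exact ((hU b).preimageHom t).eventually_preimageHom_eq s
  · intro s O hO
    obtain ⟨c, hcB, hsc, hcO⟩ := hB.mem_nhds_iff.1 hO
    obtain ⟨W, hW, hWc⟩ := hν.isOpen_iff.1 (hB.isOpen hcB)
    obtain ⟨V, hV, hsV, hVW⟩ := hY.exists_subset_of_mem_open
      (show s ∈ ν ⁻¹' W from hWc.symm ▸ hsc) hW
    -- `V` witnesses that the pair `(d, c)` admits an interpolating clopen set.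
    obtain ⟨d, hdB, hsd, hdV⟩ := hB.exists_subset_of_mem_open
      (show s ∈ ν ⁻¹' V from hsV) (hV.isOpen.preimage hν.continuous)
    obtain ⟨h1, h2⟩ := hUB (⟨d, hdB⟩, ⟨c, hcB⟩)
      ⟨V, hV, hdV, (Set.preimage_mono hVW).trans hWc.le⟩
    set V' := U (⟨d, hdB⟩, ⟨c, hcB⟩)
    have hmem : ∀ t : S, ν 1 ∈ preimageHom S Y t V' ↔ ν t ∈ V' := fun t => by
      rw [mem_preimageHom, ← map_smul, op_smul_eq_mul, one_mul]
    refine ⟨V', ⟨(1, _), congrFun (map_one (preimageHom S Y)) V'⟩,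
      fun t ht => hcO (h2 ((hmem t).1 ?_))⟩
    rw [ht]
    exact (hmem s).2 (h1 hsd)

end Universality

theorem theorem5 :
    -- `ℕ ^ ℕ` is a Polish r-NA monoid, universal for separable metrizable r-NA monoids
    (PolishSpace (Function.End ℕ) ∧
      IsRightNA (Function.End ℕ) ∧
      ∀ (S : Type u) [Monoid S] [TopologicalSpace S] [ContinuousMul S]
        [SeparableSpace S] [MetrizableSpace S],
        IsRightNA S → EmbedsAsTopologicalSubmonoid S (Function.End ℕ)) ∧
    -- for every infinite `D`, with `κ = #D`, `D ^ D` is an r-NA monoid of weight `κ`, universal for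
    -- r-NA monoids of weight at most `κ`
    (∀ (D : Type v) [Infinite D],
      IsRightNA (Function.End D) ∧
      topWeight (Function.End D) = #D ∧
      ∀ (S : Type u) [Monoid S] [TopologicalSpace S] [ContinuousMul S],
        IsRightNA S → Cardinal.lift.{v} (topWeight S) ≤ Cardinal.lift.{u} #D →
        EmbedsAsTopologicalSubmonoid S (Function.End D)) := by
  refine ⟨⟨Function.End.polishSpace_nat, Function.End.isRightNA ℕ, ?_⟩, fun D _ =>
    ⟨Function.End.isRightNA D, Function.End.topWeight_eq D,
      fun S _ _ _ hS hw => hS.embedsAsTopologicalSubmonoid D hw⟩⟩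
  intro S _ _ _ _ _ hS
  let _ := metrizableSpaceMetric S
  have _ : SecondCountableTopology S := UniformSpace.secondCountable_of_separable S
  exact hS.embedsAsTopologicalSubmonoid ℕ (by simpa using topWeight_le_aleph0 S)
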